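/- Let $a<b$ be real numbers, $0<\alpha<1$, and let $m,\bar n\in\mathbb N=\{1,2,\dots\}$. **Operators.** Put $\varphi(t)=\dfrac{t}{\sqrt[2m]{1+t^{2m}}}$ and $\Phi(t)=\frac14\left[\varphi(t+1)-\varphi(t-1)\right]$ for $t\in\mathbb R$. For $n\in\mathbb N$ with $\lceil na\rceil\le\lfloor nb\rfloor$ and $f\in C([a,b])$ let $$(A_nf)(x)=\frac{\sum_{k=\lceil na\rceil}^{\lfloor nb\rfloor}f\left(\frac kn\right)\Phi(nx-k)}{\sum_{k=\lceil na\rceil}^{\lfloor nb\rfloor}\Phi(nx-k)},\qquad x\in[a,b].$$ **Fractional derivatives.** For $x\in[a,b]$ and $g$ absolutely continuous on $[x,b]$ (respectively on $[a,x]$) the left (respectively right) Caputo derivative of order $\alpha$ is $$(D_{*x}^{\alpha}g)(y)=\frac{1}{\Gamma(1-\alpha)}\int_x^y (y-t)^{-\alpha}g'(t)\,dt\ \ (y\in[x,b]),\qquad (D_{x-}^{\alpha}g)(y)=\frac{-1}{\Gamma(1-\alpha)}\int_y^x (z-y)^{-\alpha}g'(z)\,dz\ \ (y\in[a,x]).$$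 $D_{*x}^{k\alpha}$ and $D_{x-}^{k\alpha}$ denote the $k$-fold iterates of $D_{*x}^{\alpha}$ and $D_{x-}^{\alpha}$ ($k\ge0$). For $\delta>0$ let $\omega_1(g,\delta)_{I}=\sup\{|g(u)-g(v)|:u,v\in I,\ |u-v|\le\delta\}$ and $$\omega_1\left(D_x^{(\bar n+1)\alpha}f,\delta\right)=\max\left\{\omega_1\left(D_{*x}^{(\bar n+1)\alpha}f,\delta\right)_{[x,b]},\ \omega_1\left(D_{x-}^{(\bar n+1)\alpha}f,\delta\right)_{[a,x]}\right\}.$$ **Statement.** Let $f:[a,b]\to\mathbb R$ be absolutely continuous with $f'\in L_\infty([a,b])$, and fix $x\in[a,b]$. Assume that $D_{*x}^{k\alpha}f$ is absolutely continuous on $[x,b]$ and $D_{x-}^{k\alpha}f$ is absolutely continuous on $[a,x]$ for $k=0,\dots,\bar n$ (so that the iterated derivatives are defined), that $D_{*x}^{k\alpha}f\in C([x,b])$ and $D_{x-}^{k\alpha}f\in C([a,x])$ for $k=0,1,\dots,\bar n+1$, and that $(D_{*x}^{i\alpha}f)(x)=0=(D_{x-}^{i\alpha}f)(x)$ for $i=2,3,\dots,\bar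 n+1$. Then for every $n\in\mathbb N$ with $n^{1-\alpha}>2$ and $\lceil na\rceil\le\lfloor nb\rfloor$, $$\left|(A_nf)(x)-f(x)\right|\le\frac{2\left(\sqrt[2m]{1+4^m}\right)\,\omega_1\left(D_x^{(\bar n+1)\alpha}f,\frac{1}{(\bar n+1)\alpha+1}\right)}{\Gamma\left((\bar n+1)\alpha+1\right)}\left\{\left[\frac{1}{n^{(\bar n+1)\alpha^2}}+\frac{(b-a)^{(\bar n+1)\alpha}}{4m\left(n^{1-\alpha}-2\right)^{2m}}\right]+\left[\frac{1}{n^{\alpha[(\bar n+1)\alpha+1]}}+\frac{(b-a)^{(\bar n+1)\alpha+1}}{4m\left(n^{1-\alpha}-2\right)^{2m}}\right]\right\}.$$ Consequently $\lim_{n\to+\infty}(A_nf)(x)=f(x)$. -/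

import Mathlib

open Filter Topology MeasureTheory

noncomputable section

/-- The algebraic sigmoid `φ(x) = x / (1 + x^{2m})^{1/(2m)}`. -/
def algSigmoid (m : ℕ) (x : ℝ) : ℝ :=
  x / (1 + x ^ (2 * m)) ^ (1 / (2 * (m : ℝ)))

/-- The density (activation) function `Φ(x) = (φ(x+1) - φ(x-1)) / 4`. -/
def algDensity (m : ℕ) (x : ℝ) : ℝ :=
  (1 / 4) * (algSigmoid m (x + 1) - algSigmoid m (x - 1))

/-- The neural network operator
`A_n(f, x) = (∑ f(k/n) Φ(nx - k)) / (∑ Φ(nx - k))`, both sums over `⌈na⌉ ≤ k ≤ ⌊nb⌋`. -/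
def nnOperator (m : ℕ) (a b : ℝ) (n : ℕ) (f : ℝ → ℝ) (x : ℝ) : ℝ :=
  (∑ k ∈ Finset.Icc ⌈(n : ℝ) * a⌉ ⌊(n : ℝ) * b⌋,
      f ((k : ℝ) / (n : ℝ)) * algDensity m ((n : ℝ) * x - (k : ℝ))) /
    (∑ k ∈ Finset.Icc ⌈(n : ℝ) * a⌉ ⌊(n : ℝ) * b⌋,
      algDensity m ((n : ℝ) * x - (k : ℝ)))

/-- The first modulus of continuity of `g` on the set `s`:
`ω₁(g, δ)_s = sup { |g u - g v| : u, v ∈ s, |u - v| ≤ δ }`. -/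
def modulusOn (g : ℝ → ℝ) (s : Set ℝ) (δ : ℝ) : ℝ :=
  sSup {r : ℝ | ∃ u ∈ s, ∃ v ∈ s, |u - v| ≤ δ ∧ r = |g u - g v|}

/-- The left Caputo fractional derivative of order `0 < α < 1` with base point `x`:
`(D_{*x}^α g)(y) = (1 / Γ(1-α)) ∫_x^y (y-t)^{-α} g'(t) dt` for `y ≥ x`, and `0` for `y < x`
(the domain of integration is then empty). It is meant for `g` absolutely continuous. -/
def leftCaputo (α x : ℝ) (g : ℝ → ℝ) (y : ℝ) : ℝ :=
  (1 / Real.Gamma (1 - α)) * ∫ t in Set.Ioc x y, (y - t) ^ (-α) * deriv g t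

/-- The right Caputo fractional derivative of order `0 < α < 1` with base point `x`:
`(D_{x-}^α g)(y) = (-1 / Γ(1-α)) ∫_y^x (z-y)^{-α} g'(z) dz` for `y ≤ x`, and `0` for `y > x`
(the domain of integration is then empty). It is meant for `g` absolutely continuous. -/
def rightCaputo (α x : ℝ) (g : ℝ → ℝ) (y : ℝ) : ℝ :=
  (-1 / Real.Gamma (1 - α)) * ∫ z in Set.Ioc y x, (z - y) ^ (-α) * deriv g z

/-- The iterated left derivative `D_{*x}^{kα} f = D_{*x}^α ⋯ D_{*x}^α f` (`k` times). -/
def iterLeftCaputo (α x : ℝ) (k : ℕ) (f : ℝ → ℝ) : ℝ → ℝ :=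
  (leftCaputo α x)^[k] f

/-- The iterated right derivative `D_{x-}^{kα} f = D_{x-}^α ⋯ D_{x-}^α f` (`k` times). -/
def iterRightCaputo (α x : ℝ) (k : ℕ) (f : ℝ → ℝ) : ℝ → ℝ :=
  (rightCaputo α x)^[k] f

/-- `ω₁(D_x^{kα} f, δ)`: the larger of the modulus of continuity of the left iterated derivative
over `[x, b]` and that of the right iterated derivative over `[a, x]`. -/
def iterModulus (α a b x : ℝ) (k : ℕ) (f : ℝ → ℝ) (δ : ℝ) : ℝ :=
  max (modulusOn (iterLeftCaputo α x k f) (Set.Icc x b) δ)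
    (modulusOn (iterRightCaputo α x k f) (Set.Icc a x) δ)

end

/-!
Every iterated Caputo derivative of positive order vanishes at its base point `x`, because the
domain of integration is empty there. Repeated Abel inversion therefore leaves no polynomial part
and gives the fractional Taylor formula `f y - f x = I ^ β (D ^ β f) y` with `β = (N + 1) α`.
Writing `W` for the modulus of continuity at scale `1 / (β + 1)`, `|D ^ β f t|` is at most
`(1 + (β + 1) |t - x|) W`, and this scale is exactly the one for which both terms integrate to the
same constant: `|f y - f x| ≤ W / Γ(β + 1) * (|y - x| ^ β + |y - x| ^ (β + 1))`.

The value `A_n f x` is a weighted mean of the samples `f (k / n)`. Samples with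
`|n x - k| < n ^ (1 - α)` are within `n ^ (-α)` of `x`. The weights of the others telescope to the
tails of the sigmoid `φ`, and are compared with the total weight, which is at least `Φ(1)` because
some integer of the grid lies within distance `1` of `n x`.
-/

noncomputable section

section RiemannLiouville

open Set

/-- The Riemann–Liouville fractional integral `(I_x^β g)(y) = (1/Γ(β)) ∫_x^y (y-t)^{β-1} g(t) dt`
of order `β > 0`, which inverts the Caputo derivative of order `β` up to a constant. It is `0`
for `y ≤ x`, where the domain of integration is empty. -/
def riemannLiouville (x β : ℝ) (g : ℝ → ℝ) (y : ℝ) : ℝ :=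
  (Real.Gamma β)⁻¹ * ∫ t in Ioo x y, (y - t) ^ (β - 1) * g t

lemma intervalIntegral_rpow_mul_sub_rpow {a b c : ℝ} (ha : 0 < a) (hb : 0 < b) (hc : 0 < c) :
    ∫ u in (0 : ℝ)..c, u ^ (b - 1) * (c - u) ^ (a - 1) =
      ProbabilityTheory.beta a b * c ^ (a + b - 1) := by
  have hbeta : Complex.betaIntegral b a = (ProbabilityTheory.beta a b : ℂ) := by
    rw [Complex.betaIntegral_eq_Gamma_mul_div _ _ (by simpa) (by simpa), ProbabilityTheory.beta,
      mul_comm, add_comm]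
    push_cast [← Complex.Gamma_ofReal]
    rfl
  apply Complex.ofReal_injective
  rw [← intervalIntegral.integral_ofReal, Complex.ofReal_mul, Complex.ofReal_cpow hc.le, ← hbeta]
  push_cast
  rw [add_comm (a : ℂ), mul_comm, ← Complex.betaIntegral_scaled _ _ hc]
  refine intervalIntegral.integral_congr fun u hu => ?_
  rw [uIcc_of_le hc.le] at hu
  push_cast [Complex.ofReal_cpow hu.1, Complex.ofReal_cpow (sub_nonneg.2 hu.2)]
  rfl

lemma integral_Ioo_rpow_mul_rpow {a b t y : ℝ} (ha : 0 < a) (hb : 0 < b) (hty : t < y) :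
    ∫ s in Ioo t y, (y - s) ^ (a - 1) * (s - t) ^ (b - 1) =
      ProbabilityTheory.beta a b * (y - t) ^ (a + b - 1) := by
  have hshift := intervalIntegral.integral_comp_sub_right (a := t) (b := y)
    (fun u => u ^ (b - 1) * (y - t - u) ^ (a - 1)) t
  rw [sub_self, intervalIntegral_rpow_mul_sub_rpow ha hb (sub_pos.2 hty)] at hshift
  rw [← integral_Ioc_eq_integral_Ioo, ← intervalIntegral.integral_of_le hty.le, ← hshift]
  simp only [sub_sub_sub_cancel_right, mul_comm]

lemma integrableOn_Ioo_rpow_mul_rpow {a b : ℝ} (ha : 0 < a) (hb : 0 < b) (t y : ℝ) :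
    IntegrableOn (fun s => (y - s) ^ (a - 1) * (s - t) ^ (b - 1)) (Ioo t y) := by
  rcases lt_or_ge t y with hty | hty
  · -- A non-integrable function would have integral `0`, but the beta integral is positive.
    refine .of_integral_ne_zero ?_
    rw [integral_Ioo_rpow_mul_rpow ha hb hty]
    exact (mul_pos (ProbabilityTheory.beta_pos ha hb)
      (Real.rpow_pos_of_pos (sub_pos.2 hty) _)).ne'
  · simp [Ioo_eq_empty_of_le hty]

lemma integral_Ioo_integral_Ioo_swap {E : Type*} [NormedAddCommGroup E] [NormedSpace ℝ E]
    {F : ℝ → ℝ → E} {x y : ℝ}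
    (hF : IntegrableOn (Function.uncurry F) {p | p.2 < p.1}
      ((volume.restrict (Ioo x y)).prod (volume.restrict (Ioo x y)))) :
    ∫ s in Ioo x y, ∫ t in Ioo x s, F s t = ∫ t in Ioo x y, ∫ s in Ioo t y, F s t := by
  have hF' := hF.integrable_indicator (measurableSet_lt measurable_snd measurable_fst)
  calc ∫ s in Ioo x y, ∫ t in Ioo x s, F s t
      = ∫ s in Ioo x y, ∫ t in Ioo x y, (Iio s).indicator (F s) t := by
        refine setIntegral_congr_fun measurableSet_Ioo fun s hs => ?_
        simp only [setIntegral_indicator measurableSet_Iio, Ioo_inter_Iio, min_eq_right hs.2.le]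
    _ = ∫ t in Ioo x y, ∫ s in Ioo x y, (Ioi t).indicator (F · t) s :=
        integral_integral_swap hF'
    _ = ∫ t in Ioo x y, ∫ s in Ioo t y, F s t := by
        refine setIntegral_congr_fun measurableSet_Ioo fun t ht => ?_
        simp only [setIntegral_indicator measurableSet_Ioi, Ioo_inter_Ioi, max_eq_right ht.1.le]

lemma integrableOn_triangle_rpow_mul_rpow_mul {a b x y : ℝ} {h : ℝ → ℝ} (ha : 0 < a) (hb : 0 < b)
    (hm : AEStronglyMeasurable h (volume.restrict (Ioo x y)))
    (hint : IntegrableOn (fun t => (y - t) ^ (a + b - 1) * h t) (Ioo x y)) :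
    IntegrableOn (fun p : ℝ × ℝ => (y - p.1) ^ (a - 1) * (p.1 - p.2) ^ (b - 1) * h p.2)
      {p | p.2 < p.1} ((volume.restrict (Ioo x y)).prod (volume.restrict (Ioo x y))) := by
  have htriangle : MeasurableSet {p : ℝ × ℝ | p.2 < p.1} :=
    measurableSet_lt measurable_snd measurable_fst
  set k : ℝ → ℝ → ℝ := fun t => (Ioi t).indicator fun s => (y - s) ^ (a - 1) * (s - t) ^ (b - 1)
  have hk_int : ∀ t ∈ Ioo x y, IntegrableOn (k t) (Ioo x y) := fun t ht => by
    rw [integrableOn_indicator_iff measurableSet_Ioi, inter_comm, Ioo_inter_Ioi,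
      max_eq_right ht.1.le]
    exact integrableOn_Ioo_rpow_mul_rpow ha hb t y
  have hk_norm : ∀ t ∈ Ioo x y, ∫ s in Ioo x y, ‖k t s‖ =
      ProbabilityTheory.beta a b * (y - t) ^ (a + b - 1) := fun t ht => by
    rw [← integral_Ioo_rpow_mul_rpow ha hb ht.2]
    simp only [k, norm_indicator_eq_indicator_norm]
    rw [setIntegral_indicator measurableSet_Ioi, Ioo_inter_Ioi, max_eq_right ht.1.le]
    refine setIntegral_congr_fun measurableSet_Ioo fun s hs => Real.norm_of_nonneg ?_
    exact mul_nonneg (Real.rpow_nonneg (sub_pos.2 hs.2).le _)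
      (Real.rpow_nonneg (sub_pos.2 hs.1).le _)
  have hk : ({p : ℝ × ℝ | p.2 < p.1}.indicator fun p : ℝ × ℝ =>
      (y - p.1) ^ (a - 1) * (p.1 - p.2) ^ (b - 1) * h p.2) = fun p => k p.2 p.1 * h p.2 := by
    ext p
    simp [k, indicator_apply]
  have hkm : AEStronglyMeasurable (fun p : ℝ × ℝ => k p.2 p.1 * h p.2)
      ((volume.restrict (Ioo x y)).prod (volume.restrict (Ioo x y))) := by
    rw [← hk]
    exact (AEStronglyMeasurable.mul (by fun_prop) hm.comp_snd).indicator htriangle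
  rw [← integrable_indicator_iff htriangle, hk, integrable_prod_iff' hkm]
  constructor
  · filter_upwards [ae_restrict_mem measurableSet_Ioo] with t ht
    exact (hk_int t ht).mul_const (h t)
  · refine (hint.norm.const_mul (ProbabilityTheory.beta a b)).congr ?_
    filter_upwards [ae_restrict_mem measurableSet_Ioo] with t ht
    simp only [norm_mul]
    rw [integral_mul_const, hk_norm t ht,
      Real.norm_of_nonneg (Real.rpow_nonneg (sub_pos.2 ht.2).le _), mul_assoc]

lemma riemannLiouville_riemannLiouville {a b x y : ℝ} {h : ℝ → ℝ} (ha : 0 < a) (hb : 0 < b)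
    (hm : AEStronglyMeasurable h (volume.restrict (Ioo x y)))
    (hint : IntegrableOn (fun t => (y - t) ^ (a + b - 1) * h t) (Ioo x y)) :
    riemannLiouville x a (riemannLiouville x b h) y = riemannLiouville x (a + b) h y := by
  have hΓa := (Real.Gamma_pos_of_pos ha).ne'
  have hΓb := (Real.Gamma_pos_of_pos hb).ne'
  calc riemannLiouville x a (riemannLiouville x b h) y
      = (Real.Gamma a)⁻¹ * (Real.Gamma b)⁻¹ * ∫ s in Ioo x y, ∫ t in Ioo x s,
          (y - s) ^ (a - 1) * (s - t) ^ (b - 1) * h t := by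
        simp only [riemannLiouville, mul_assoc, mul_left_comm _ (Real.Gamma b)⁻¹,
          integral_const_mul]
    _ = (Real.Gamma a)⁻¹ * (Real.Gamma b)⁻¹ * ∫ t in Ioo x y,
          ProbabilityTheory.beta a b * ((y - t) ^ (a + b - 1) * h t) := by
        rw [integral_Ioo_integral_Ioo_swap
          (F := fun s t => (y - s) ^ (a - 1) * (s - t) ^ (b - 1) * h t)
          (integrableOn_triangle_rpow_mul_rpow_mul ha hb hm hint)]
        congr 1
        refine setIntegral_congr_fun measurableSet_Ioo fun t ht => ?_
        rw [integral_mul_const, integral_Ioo_rpow_mul_rpow ha hb ht.2, mul_assoc]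
    _ = riemannLiouville x (a + b) h y := by
        rw [integral_const_mul, riemannLiouville, ProbabilityTheory.beta]
        field_simp

lemma riemannLiouville_congr {β x y : ℝ} {g h : ℝ → ℝ} (hgh : EqOn g h (Ioo x y)) :
    riemannLiouville x β g y = riemannLiouville x β h y := by
  unfold riemannLiouville
  congr 1
  exact setIntegral_congr_fun measurableSet_Ioo fun t ht => by simp only [hgh ht]

lemma integrableOn_rpow_mul_of_continuousOn {β x y : ℝ} {g : ℝ → ℝ} (hβ : 0 < β)
    (hg : ContinuousOn g (Icc x y)) :
    IntegrableOn (fun t => (y - t) ^ (β - 1) * g t) (Ioo x y) := by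
  obtain ⟨C, hC⟩ := isCompact_Icc.exists_bound_of_continuousOn hg
  have hkernel : IntegrableOn (fun t => (y - t) ^ (β - 1)) (Ioo x y) := by
    simpa using integrableOn_Ioo_rpow_mul_rpow hβ one_pos x y
  refine hkernel.mul_bdd (c := C)
    ((hg.mono Ioo_subset_Icc_self).aestronglyMeasurable measurableSet_Ioo) ?_
  filter_upwards [ae_restrict_mem measurableSet_Ioo] with t ht
  exact hC t (Ioo_subset_Icc_self ht)

lemma riemannLiouville_riemannLiouville_of_continuousOn {a b x y : ℝ} {h : ℝ → ℝ} (ha : 0 < a)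
    (hb : 0 < b) (hh : ContinuousOn h (Icc x y)) :
    riemannLiouville x a (riemannLiouville x b h) y = riemannLiouville x (a + b) h y :=
  riemannLiouville_riemannLiouville ha hb
    ((hh.mono Ioo_subset_Icc_self).aestronglyMeasurable measurableSet_Ioo)
    (integrableOn_rpow_mul_of_continuousOn (add_pos ha hb) hh)

lemma riemannLiouville_sub_rpow {β c x y : ℝ} (hβ : 0 < β) (hc : 0 < c) (hxy : x < y) :
    riemannLiouville x β (fun t => (t - x) ^ (c - 1)) y =
      Real.Gamma c / Real.Gamma (β + c) * (y - x) ^ (β + c - 1) := by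
  have := (Real.Gamma_pos_of_pos hβ).ne'
  rw [riemannLiouville, integral_Ioo_rpow_mul_rpow hβ hc hxy, ProbabilityTheory.beta]
  field_simp

lemma riemannLiouville_affine {β x y : ℝ} (hβ : 0 < β) (hxy : x ≤ y) (A B : ℝ) :
    riemannLiouville x β (fun t => A + B * (t - x)) y =
      A * ((y - x) ^ β / Real.Gamma (β + 1)) + B * ((y - x) ^ (β + 1) / Real.Gamma (β + 2)) := by
  rcases hxy.eq_or_lt with rfl | hxy
  · simp [riemannLiouville, hβ.ne', (by positivity : β + 1 ≠ 0)]
  · have hone := riemannLiouville_sub_rpow hβ one_pos hxy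
    have hid := riemannLiouville_sub_rpow hβ two_pos hxy
    have hint_one := integrableOn_Ioo_rpow_mul_rpow hβ one_pos x y
    have hint_id := integrableOn_Ioo_rpow_mul_rpow hβ two_pos x y
    norm_num [riemannLiouville, Real.Gamma_two, add_sub_assoc]
      at hone hid hint_one hint_id ⊢
    have hsplit : (fun t => (y - t) ^ (β - 1) * (A + B * (t - x))) =
        fun t => A * (y - t) ^ (β - 1) + B * ((y - t) ^ (β - 1) * (t - x)) := by
      ext t
      ring
    rw [hsplit, integral_add (hint_one.const_mul A) (hint_id.const_mul B), integral_const_mul,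
      integral_const_mul]
    linear_combination A * hone + B * hid

lemma abs_riemannLiouville_le {β x y : ℝ} {g h : ℝ → ℝ} (hβ : 0 < β)
    (hh : ContinuousOn h (Icc x y)) (hgh : ∀ t ∈ Ioo x y, |g t| ≤ h t) :
    |riemannLiouville x β g y| ≤ riemannLiouville x β h y := by
  have hΓ := inv_nonneg.2 (Real.Gamma_pos_of_pos hβ).le
  rw [riemannLiouville, abs_mul, abs_of_nonneg hΓ]
  refine mul_le_mul_of_nonneg_left ?_ hΓ
  rw [← Real.norm_eq_abs]
  refine norm_integral_le_of_norm_le (integrableOn_rpow_mul_of_continuousOn hβ hh) ?_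
  filter_upwards [ae_restrict_mem measurableSet_Ioo] with t ht
  have hpow : 0 ≤ (y - t) ^ (β - 1) := Real.rpow_nonneg (sub_pos.2 ht.2).le _
  rw [norm_mul, Real.norm_of_nonneg hpow]
  exact mul_le_mul_of_nonneg_left (hgh t ht) hpow

end RiemannLiouville

section CaputoTaylor

open Set

lemma leftCaputo_eq_riemannLiouville (α x : ℝ) (g : ℝ → ℝ) :
    leftCaputo α x g = riemannLiouville x (1 - α) (deriv g) := by
  ext y
  rw [leftCaputo, riemannLiouville, integral_Ioc_eq_integral_Ioo, one_div, sub_sub_cancel_left]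

lemma riemannLiouville_one_deriv {x y : ℝ} {g : ℝ → ℝ} (hxy : x ≤ y)
    (hg : AbsolutelyContinuousOnInterval g x y) :
    riemannLiouville x 1 (deriv g) y = g y - g x := by
  simp [riemannLiouville, ← integral_Ioc_eq_integral_Ioo, ← intervalIntegral.integral_of_le hxy,
    hg.integral_deriv_eq_sub]

lemma riemannLiouville_leftCaputo {α x y : ℝ} {g : ℝ → ℝ} (hα0 : 0 < α) (hα1 : α < 1)
    (hxy : x ≤ y) (hg : AbsolutelyContinuousOnInterval g x y) :
    riemannLiouville x α (leftCaputo α x g) y = g y - g x := by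
  have hint : IntegrableOn (deriv g) (Ioo x y) :=
    (hg.intervalIntegrable_deriv.1).mono_set Ioo_subset_Ioc_self
  rw [leftCaputo_eq_riemannLiouville, riemannLiouville_riemannLiouville hα0 (sub_pos.2 hα1)
    hint.aestronglyMeasurable (by simpa using hint), add_sub_cancel,
    riemannLiouville_one_deriv hxy hg]

lemma iterLeftCaputo_succ (α x : ℝ) (k : ℕ) (f : ℝ → ℝ) :
    iterLeftCaputo α x (k + 1) f = leftCaputo α x (iterLeftCaputo α x k f) :=
  Function.iterate_succ_apply' ..

lemma iterRightCaputo_succ (α x : ℝ) (k : ℕ) (f : ℝ → ℝ) :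
    iterRightCaputo α x (k + 1) f = rightCaputo α x (iterRightCaputo α x k f) :=
  Function.iterate_succ_apply' ..

lemma iterLeftCaputo_succ_self (α x : ℝ) (k : ℕ) (f : ℝ → ℝ) :
    iterLeftCaputo α x (k + 1) f x = 0 := by
  simp [iterLeftCaputo_succ, leftCaputo]

lemma sub_eq_riemannLiouville_iterLeftCaputo {α x b y : ℝ} {f : ℝ → ℝ} {N : ℕ} (hα0 : 0 < α)
    (hα1 : α < 1) (hac : ∀ k ≤ N, AbsolutelyContinuousOnInterval (iterLeftCaputo α x k f) x b)
    (hcont : ContinuousOn (iterLeftCaputo α x (N + 1) f) (Icc x b)) (hy : y ∈ Icc x b) :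
    f y - f x = riemannLiouville x ((N + 1) * α) (iterLeftCaputo α x (N + 1) f) y := by
  have habel : ∀ k ≤ N, ∀ t ∈ Icc x b, riemannLiouville x α (iterLeftCaputo α x (k + 1) f) t =
      iterLeftCaputo α x k f t - iterLeftCaputo α x k f x := fun k hk t ht => by
    rw [iterLeftCaputo_succ]
    refine riemannLiouville_leftCaputo hα0 hα1 ht.1 ((hac k hk).mono ?_)
    rw [uIcc_of_le ht.1, uIcc_of_le (ht.1.trans ht.2)]
    exact Icc_subset_Icc_right ht.2
  induction N with
  | zero => simpa [iterLeftCaputo] using (habel 0 le_rfl y hy).symm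
  | succ N ih =>
    have hcont_N : ContinuousOn (iterLeftCaputo α x (N + 1) f) (Icc x b) := by
      simpa only [uIcc_of_le (hy.1.trans hy.2)] using (hac (N + 1) le_rfl).continuousOn
    have hinner : EqOn (iterLeftCaputo α x (N + 1) f)
        (riemannLiouville x α (iterLeftCaputo α x (N + 1 + 1) f)) (Ioo x y) := fun t ht => by
      rw [habel (N + 1) le_rfl t ⟨ht.1.le, ht.2.le.trans hy.2⟩, iterLeftCaputo_succ_self, sub_zero]
    rw [ih (fun k hk => hac k (hk.trans N.le_succ)) hcont_N
        (fun k hk => habel k (hk.trans N.le_succ)),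
      riemannLiouville_congr hinner, riemannLiouville_riemannLiouville_of_continuousOn
        (by positivity) hα0 (hcont.mono (Icc_subset_Icc_right hy.2))]
    push_cast
    ring_nf

end CaputoTaylor

section Modulus

open Set

lemma modulusOn_nonneg (g : ℝ → ℝ) (s : Set ℝ) (δ : ℝ) : 0 ≤ modulusOn g s δ :=
  Real.sSup_nonneg (by rintro _ ⟨u, -, v, -, -, rfl⟩; exact abs_nonneg _)

lemma abs_sub_le_modulusOn {g : ℝ → ℝ} {s : Set ℝ} {δ u v : ℝ}
    (hg : Bornology.IsBounded (g '' s)) (hu : u ∈ s) (hv : v ∈ s) (huv : |u - v| ≤ δ) :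
    |g u - g v| ≤ modulusOn g s δ := by
  refine le_csSup ⟨Metric.diam (g '' s), ?_⟩ ⟨u, hu, v, hv, huv, rfl⟩
  rintro _ ⟨p, hp, q, hq, -, rfl⟩
  exact Metric.dist_le_diam_of_mem hg (mem_image_of_mem g hp) (mem_image_of_mem g hq)

lemma abs_sub_le_nat_mul_modulusOn {g : ℝ → ℝ} {s : Set ℝ} {δ u v : ℝ} {j : ℕ}
    (hs : Convex ℝ s) (hg : Bornology.IsBounded (g '' s)) (hu : u ∈ s) (hv : v ∈ s)
    (hj : 0 < j) (huv : |u - v| ≤ j * δ) :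
    |g u - g v| ≤ j * modulusOn g s δ := by
  have hj' : (0 : ℝ) < j := Nat.cast_pos.2 hj
  set p : ℕ → ℝ := fun i => AffineMap.lineMap u v (i / j : ℝ)
  have hp : ∀ i ≤ j, p i ∈ s := fun i hi => hs.lineMap_mem hu hv
    ⟨by positivity, (div_le_one hj').2 (Nat.cast_le.2 hi)⟩
  have hchain : dist (g (p 0)) (g (p j)) ≤ ∑ _i ∈ Finset.range j, modulusOn g s δ := by
    refine dist_le_range_sum_of_dist_le (f := g ∘ p) j fun {i} hi => ?_
    refine abs_sub_le_modulusOn hg (hp i hi.le) (hp (i + 1) hi) ?_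
    rw [← Real.dist_eq, dist_lineMap_lineMap, Real.dist_eq, Real.dist_eq, ← sub_div,
      Nat.cast_succ, sub_add_cancel_left, abs_div, abs_neg, abs_one, Nat.abs_cast,
      one_div_mul_eq_div, div_le_iff₀' hj']
    exact huv
  simpa [p, hj'.ne', Real.dist_eq] using hchain

lemma abs_sub_le_one_add_mul_modulusOn {g : ℝ → ℝ} {s : Set ℝ} {δ u v : ℝ} (hs : Convex ℝ s)
    (hg : Bornology.IsBounded (g '' s)) (hδ : 0 < δ) (hu : u ∈ s) (hv : v ∈ s) :
    |g u - g v| ≤ (1 + |u - v| / δ) * modulusOn g s δ := by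
  rcases (abs_nonneg (u - v)).eq_or_lt with huv | huv
  · exact (abs_sub_le_modulusOn hg hu hv (huv ▸ hδ.le)).trans
      (by simp [← huv])
  calc |g u - g v| ≤ ⌈|u - v| / δ⌉₊ * modulusOn g s δ :=
        abs_sub_le_nat_mul_modulusOn hs hg hu hv (Nat.ceil_pos.2 (by positivity))
          ((div_le_iff₀ hδ).1 (Nat.le_ceil _))
    _ ≤ (1 + |u - v| / δ) * modulusOn g s δ := by
        gcongr
        · exact modulusOn_nonneg g s δ
        · rw [add_comm]
          exact (Nat.ceil_lt_add_one (by positivity)).le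

lemma iterModulus_nonneg (α a b x : ℝ) (k : ℕ) (f : ℝ → ℝ) (δ : ℝ) :
    0 ≤ iterModulus α a b x k f δ :=
  (modulusOn_nonneg ..).trans (le_max_left ..)

lemma modulusOn_comp_neg (g : ℝ → ℝ) (s : Set ℝ) (δ : ℝ) :
    modulusOn (fun t => g (-t)) s δ = modulusOn g (-s) δ := by
  unfold modulusOn
  congr 1
  ext r
  constructor
  · rintro ⟨u, hu, v, hv, huv, rfl⟩
    exact ⟨-u, by simpa, -v, by simpa, by rwa [neg_sub_neg, abs_sub_comm], rfl⟩
  · rintro ⟨u, hu, v, hv, huv, rfl⟩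
    exact ⟨-u, hu, -v, hv, by rwa [neg_sub_neg, abs_sub_comm], by simp⟩

end Modulus

section FractionalTaylorEstimate

open Set

lemma abs_sub_le_modulusOn_iterLeftCaputo {α x b y : ℝ} {f : ℝ → ℝ} {N : ℕ} (hα0 : 0 < α)
    (hα1 : α < 1) (hac : ∀ k ≤ N, AbsolutelyContinuousOnInterval (iterLeftCaputo α x k f) x b)
    (hcont : ContinuousOn (iterLeftCaputo α x (N + 1) f) (Icc x b)) (hy : y ∈ Icc x b) :
    |f y - f x| ≤
      modulusOn (iterLeftCaputo α x (N + 1) f) (Icc x b) (1 / ((N + 1) * α + 1)) /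
        Real.Gamma ((N + 1) * α + 1) *
          (|y - x| ^ ((N + 1) * α) + |y - x| ^ ((N + 1) * α + 1)) := by
  set β : ℝ := (N + 1) * α
  set W := modulusOn (iterLeftCaputo α x (N + 1) f) (Icc x b) (1 / (β + 1))
  have hβ : 0 < β := by positivity
  have hΓ := (Real.Gamma_pos_of_pos (by positivity : 0 < β + 1)).ne'
  have hderiv : ∀ t ∈ Ioo x y, |iterLeftCaputo α x (N + 1) f t| ≤ W + (β + 1) * W * (t - x) :=
    fun t ht => by
    have hmod := abs_sub_le_one_add_mul_modulusOn (δ := 1 / (β + 1)) (convex_Icc x b)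
      (isCompact_Icc.image_of_continuousOn hcont).isBounded (by positivity)
      (show t ∈ Icc x b from ⟨ht.1.le, ht.2.le.trans hy.2⟩) (left_mem_Icc.2 (hy.1.trans hy.2))
    rw [iterLeftCaputo_succ_self, sub_zero, abs_of_pos (sub_pos.2 ht.1), div_div_eq_mul_div,
      div_one] at hmod
    exact hmod.trans_eq (by ring)
  calc |f y - f x| = |riemannLiouville x β (iterLeftCaputo α x (N + 1) f) y| := by
        rw [sub_eq_riemannLiouville_iterLeftCaputo hα0 hα1 hac hcont hy]
    _ ≤ riemannLiouville x β (fun t => W + (β + 1) * W * (t - x)) y :=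
        abs_riemannLiouville_le hβ (by fun_prop) hderiv
    _ = W / Real.Gamma (β + 1) * (|y - x| ^ β + |y - x| ^ (β + 1)) := by
        rw [riemannLiouville_affine hβ hy.1, abs_of_nonneg (sub_nonneg.2 hy.1),
          show β + 2 = β + 1 + 1 by ring, Real.Gamma_add_one (by positivity : β + 1 ≠ 0)]
        field_simp

lemma disjoint_uIoc_neg {a b c d : ℝ} (h : Disjoint (uIoc (-a) (-b)) (uIoc (-c) (-d))) :
    Disjoint (uIoc a b) (uIoc c d) := by
  simpa only [uIoc, Ioc_disjoint_Ioc, max_neg_neg, min_neg_neg, neg_le_neg_iff, max_comm, min_comm]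
    using h

lemma absolutelyContinuousOnInterval_comp_neg {E : Type*} [PseudoMetricSpace E] {f : ℝ → E}
    {a b : ℝ} (hf : AbsolutelyContinuousOnInterval f a b) :
    AbsolutelyContinuousOnInterval (fun t => f (-t)) (-a) (-b) := by
  have hneg : ∀ {t : ℝ}, t ∈ uIcc (-a) (-b) → -t ∈ uIcc a b := fun {t} ht => by
    have := mem_image_of_mem Neg.neg ht
    rwa [image_neg_uIcc, neg_neg, neg_neg] at this
  rw [absolutelyContinuousOnInterval_iff] at hf ⊢
  intro ε hε
  obtain ⟨δ, hδ, hfδ⟩ := hf ε hε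
  refine ⟨δ, hδ, fun I hI hlen => ?_⟩
  refine hfδ (I.1, fun i => (-(I.2 i).1, -(I.2 i).2)) ⟨fun i hi => ?_, fun i hi j hj hij => ?_⟩ ?_
  · exact ⟨hneg (hI.1 i hi).1, hneg (hI.1 i hi).2⟩
  · exact disjoint_uIoc_neg (by simpa only [Function.onFun, neg_neg] using hI.2 hi hj hij)
  · simpa only [dist_neg_neg] using hlen

lemma rightCaputo_eq_leftCaputo (α x : ℝ) (g : ℝ → ℝ) (y : ℝ) :
    rightCaputo α x g y = leftCaputo α (-x) (fun t => g (-t)) (-y) := by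
  rcases le_total x y with hxy | hxy
  · simp [rightCaputo, leftCaputo, hxy]
  have hreflect := intervalIntegral.integral_comp_neg (a := -x) (b := -y)
    fun z => (z - y) ^ (-α) * deriv g z
  rw [neg_neg, neg_neg] at hreflect
  rw [rightCaputo, leftCaputo, ← intervalIntegral.integral_of_le hxy,
    ← intervalIntegral.integral_of_le (neg_le_neg hxy), ← hreflect, neg_div, neg_mul, ← mul_neg,
    ← intervalIntegral.integral_neg]
  simp only [deriv_comp_neg, mul_neg, neg_sub_left, add_comm]

lemma iterLeftCaputo_comp_neg (α x : ℝ) (k : ℕ) (f : ℝ → ℝ) :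
    iterLeftCaputo α (-x) k (fun t => f (-t)) = fun t => iterRightCaputo α x k f (-t) := by
  induction k with
  | zero => rfl
  | succ k ih =>
    ext t
    rw [iterLeftCaputo_succ, ih, iterRightCaputo_succ, rightCaputo_eq_leftCaputo, neg_neg]

lemma abs_sub_le_modulusOn_iterRightCaputo {α a x y : ℝ} {f : ℝ → ℝ} {N : ℕ} (hα0 : 0 < α)
    (hα1 : α < 1) (hac : ∀ k ≤ N, AbsolutelyContinuousOnInterval (iterRightCaputo α x k f) a x)
    (hcont : ContinuousOn (iterRightCaputo α x (N + 1) f) (Icc a x)) (hy : y ∈ Icc a x) :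
    |f y - f x| ≤
      modulusOn (iterRightCaputo α x (N + 1) f) (Icc a x) (1 / ((N + 1) * α + 1)) /
        Real.Gamma ((N + 1) * α + 1) *
          (|y - x| ^ ((N + 1) * α) + |y - x| ^ ((N + 1) * α + 1)) := by
  have hac_neg : ∀ k ≤ N, AbsolutelyContinuousOnInterval
      (iterLeftCaputo α (-x) k fun t => f (-t)) (-x) (-a) := fun k hk => by
    rw [iterLeftCaputo_comp_neg]
    exact absolutelyContinuousOnInterval_comp_neg (hac k hk).symm
  have hcont_neg : ContinuousOn (iterLeftCaputo α (-x) (N + 1) fun t => f (-t))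
      (Icc (-x) (-a)) := by
    rw [iterLeftCaputo_comp_neg]
    exact hcont.comp continuousOn_neg fun t ht => by simpa [neg_le, le_neg, and_comm] using ht
  have hleft := abs_sub_le_modulusOn_iterLeftCaputo hα0 hα1 hac_neg hcont_neg (y := -y)
    ⟨neg_le_neg hy.2, neg_le_neg hy.1⟩
  simpa only [iterLeftCaputo_comp_neg, modulusOn_comp_neg, neg_Icc, neg_neg, neg_sub_neg,
    abs_sub_comm x y] using hleft

lemma abs_sub_le_iterModulus {α a b x y : ℝ} {f : ℝ → ℝ} {N : ℕ} (hα0 : 0 < α) (hα1 : α < 1)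
    (hLac : ∀ k ≤ N, AbsolutelyContinuousOnInterval (iterLeftCaputo α x k f) x b)
    (hRac : ∀ k ≤ N, AbsolutelyContinuousOnInterval (iterRightCaputo α x k f) a x)
    (hLc : ContinuousOn (iterLeftCaputo α x (N + 1) f) (Icc x b))
    (hRc : ContinuousOn (iterRightCaputo α x (N + 1) f) (Icc a x)) (hy : y ∈ Icc a b) :
    |f y - f x| ≤ iterModulus α a b x (N + 1) f (1 / ((N + 1) * α + 1)) /
      Real.Gamma ((N + 1) * α + 1) *
        (|y - x| ^ ((N + 1) * α) + |y - x| ^ ((N + 1) * α + 1)) := by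
  have := Real.Gamma_pos_of_pos (by positivity : 0 < (N + 1) * α + 1)
  rcases le_total x y with hxy | hyx
  · refine (abs_sub_le_modulusOn_iterLeftCaputo hα0 hα1 hLac hLc ⟨hxy, hy.2⟩).trans ?_
    gcongr
    exact le_max_left ..
  · refine (abs_sub_le_modulusOn_iterRightCaputo hα0 hα1 hRac hRc ⟨hy.1, hyx⟩).trans ?_
    gcongr
    exact le_max_right ..

end FractionalTaylorEstimate

section AlgDensity

lemma one_add_pow_two_mul_pos (m : ℕ) (x : ℝ) : 0 < 1 + x ^ (2 * m) := by
  have := (even_two_mul m).pow_nonneg x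
  positivity

lemma algSigmoid_neg (m : ℕ) (x : ℝ) : algSigmoid m (-x) = -algSigmoid m x := by
  rw [algSigmoid, algSigmoid, (even_two_mul m).neg_pow, neg_div]

lemma algSigmoid_zero (m : ℕ) : algSigmoid m 0 = 0 := by
  simp [algSigmoid]

lemma algSigmoid_eq_inv {m : ℕ} (hm : m ≠ 0) {x : ℝ} (hx : 0 < x) :
    algSigmoid m x = ((1 + x⁻¹ ^ (2 * m)) ^ (1 / (2 * (m : ℝ))))⁻¹ := by
  have hfactor : 1 + x ^ (2 * m) = x ^ (2 * m) * (1 + x⁻¹ ^ (2 * m)) := by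
    rw [mul_add, ← mul_pow, mul_inv_cancel₀ hx.ne', one_pow, mul_one, add_comm]
  have hroot : (x ^ (2 * m)) ^ (1 / (2 * (m : ℝ))) = x := by
    simpa using Real.pow_rpow_inv_natCast hx.le (mul_ne_zero two_ne_zero hm)
  rw [algSigmoid, hfactor, Real.mul_rpow (by positivity) (by positivity), hroot]
  field_simp

lemma algSigmoid_monotone {m : ℕ} (hm : m ≠ 0) : Monotone (algSigmoid m) := by
  refine monotone_of_odd_of_monotoneOn_nonneg (algSigmoid_neg m) fun x hx y hy hxy => ?_
  rcases (Set.mem_Ici.1 hx).eq_or_lt with rfl | hx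
  · rw [algSigmoid_zero]
    exact div_nonneg hy (Real.rpow_nonneg (one_add_pow_two_mul_pos m y).le _)
  · have hy : 0 < y := hx.trans_le hxy
    rw [algSigmoid_eq_inv hm hx, algSigmoid_eq_inv hm hy]
    gcongr

lemma algSigmoid_le_one {m : ℕ} (hm : m ≠ 0) (x : ℝ) : algSigmoid m x ≤ 1 := by
  refine (algSigmoid_monotone hm (le_max_left x 1)).trans ?_
  have hpos : 0 < max x 1 := lt_max_of_lt_right one_pos
  rw [algSigmoid_eq_inv hm hpos]
  exact inv_le_one_of_one_le₀ (Real.one_le_rpow (le_add_of_nonneg_right (by positivity))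
    (by positivity))

lemma algSigmoid_add_le (m : ℕ) {u v : ℝ} (hu : 0 ≤ u) (hv : 0 ≤ v) :
    algSigmoid m (u + v) ≤ algSigmoid m u + algSigmoid m v := by
  simp only [algSigmoid, add_div]
  gcongr <;> linarith

lemma one_sub_algSigmoid_le {m : ℕ} (hm : m ≠ 0) {s : ℝ} (hs : 0 < s) :
    1 - algSigmoid m s ≤ 1 / (2 * m * s ^ (2 * m)) := by
  have hm1 : (1 : ℝ) ≤ m := Nat.one_le_cast.2 (Nat.one_le_iff_ne_zero.2 hm)
  have hu : 0 < s⁻¹ ^ (2 * m) := by positivity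
  rw [algSigmoid_eq_inv hm hs]
  set A := (1 + s⁻¹ ^ (2 * m)) ^ (1 / (2 * (m : ℝ)))
  have hA : 0 < A := by positivity
  calc 1 - A⁻¹ ≤ A - 1 :=
        (Real.one_sub_inv_le_log_of_pos hA).trans (Real.log_le_sub_one_of_pos hA)
    _ ≤ 1 / (2 * m) * s⁻¹ ^ (2 * m) := by
        rw [sub_le_iff_le_add']
        exact rpow_one_add_le_one_add_mul_self (by linarith) (by positivity)
          ((div_le_one (by positivity)).2 (by linarith))
    _ = 1 / (2 * m * s ^ (2 * m)) := by
        rw [inv_pow, ← one_div, one_div_mul_one_div]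

lemma algDensity_neg (m : ℕ) (x : ℝ) : algDensity m (-x) = algDensity m x := by
  rw [algDensity, algDensity, show -x + 1 = -(x - 1) by ring, show -x - 1 = -(x + 1) by ring,
    algSigmoid_neg, algSigmoid_neg]
  ring

lemma algDensity_nonneg {m : ℕ} (hm : m ≠ 0) (x : ℝ) : 0 ≤ algDensity m x :=
  mul_nonneg (by norm_num) (sub_nonneg.2 (algSigmoid_monotone hm (by linarith)))

lemma algDensity_one (m : ℕ) : algDensity m 1 = algSigmoid m 2 / 4 := by
  rw [algDensity, sub_self, algSigmoid_zero, sub_zero, one_add_one_eq_two, one_div_mul_eq_div]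

lemma inv_algDensity_one (m : ℕ) :
    (algDensity m 1)⁻¹ = 2 * (1 + (4 : ℝ) ^ m) ^ (1 / (2 * (m : ℝ))) := by
  rw [algDensity_one, algSigmoid, pow_mul, show (2 : ℝ) ^ 2 = 4 by norm_num, inv_div,
    div_div_eq_mul_div]
  ring

lemma algDensity_one_pos (m : ℕ) : 0 < algDensity m 1 := by
  rw [← inv_pos, inv_algDensity_one]
  positivity

lemma algDensity_one_le {m : ℕ} {t : ℝ} (ht : |t| ≤ 1) : algDensity m 1 ≤ algDensity m t := by
  obtain ⟨hlo, hhi⟩ := abs_le.1 ht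
  have hsub := algSigmoid_add_le m (neg_le_iff_add_nonneg.1 hlo) (sub_nonneg.2 hhi)
  rw [show t + 1 + (1 - t) = 2 by ring, ← neg_sub t 1, algSigmoid_neg] at hsub
  rw [algDensity_one, algDensity]
  linarith

end AlgDensity

section AlgDensitySums

lemma sum_Icc_sub_succ {M : Type*} [AddCommGroup M] (F : ℤ → M) {p q : ℤ} (hpq : p ≤ q) :
    ∑ k ∈ Finset.Icc p q, (F k - F (k + 1)) = F p - F (q + 1) := by
  induction q, hpq using Int.leInduction with
  | base => simp
  | succ q hpq ih =>
    rw [← Finset.insert_Icc_right_eq_Icc_add_one (by omega), Finset.sum_insert (by simp), ih,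
      add_comm, sub_add_sub_cancel]

lemma sum_Icc_algDensity (m : ℕ) (t : ℝ) {p q : ℤ} (hpq : p ≤ q) :
    ∑ k ∈ Finset.Icc p q, algDensity m (t - k) =
      (algSigmoid m (t - p + 1) + algSigmoid m (t - p) -
        (algSigmoid m (t - q) + algSigmoid m (t - q - 1))) / 4 := by
  have htelescope := sum_Icc_sub_succ
    (fun k : ℤ => (algSigmoid m (t - k + 1) + algSigmoid m (t - k)) / 4) hpq
  push_cast [← sub_sub, sub_add_cancel] at htelescope
  rw [sub_div, ← htelescope]
  refine Finset.sum_congr rfl fun k _ => ?_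
  rw [algDensity]
  ring

lemma sum_algDensity_le_of_le_sub {m : ℕ} (hm : m ≠ 0) {t M : ℝ} (hM : 1 < M) (s : Finset ℤ)
    (hs : ∀ k ∈ s, M ≤ t - k) :
    ∑ k ∈ s, algDensity m (t - k) ≤ 1 / (4 * m * (M - 1) ^ (2 * m)) := by
  have hM1 : 0 < M - 1 := sub_pos.2 hM
  rcases s.eq_empty_or_nonempty with rfl | hne
  · rw [Finset.sum_empty]
    positivity
  set p := s.min' hne
  set q := s.max' hne
  have hMq : M ≤ t - q := hs q (s.max'_mem hne)
  have hsub : s ⊆ Finset.Icc p q := fun k hk => Finset.mem_Icc.2 ⟨s.min'_le k hk, s.le_max' k hk⟩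
  have hmono := algSigmoid_monotone hm
  calc ∑ k ∈ s, algDensity m (t - k)
      ≤ ∑ k ∈ Finset.Icc p q, algDensity m (t - k) :=
        Finset.sum_le_sum_of_subset_of_nonneg hsub fun k _ _ => algDensity_nonneg hm _
    _ ≤ (1 - algSigmoid m (M - 1)) / 2 := by
        rw [sum_Icc_algDensity m t (s.min'_le_max' hne)]
        linarith [algSigmoid_le_one hm (t - p + 1), algSigmoid_le_one hm (t - p),
          hmono (show M - 1 ≤ t - q by linarith), hmono (show M - 1 ≤ t - q - 1 by linarith)]
    _ ≤ 1 / (2 * m * (M - 1) ^ (2 * m)) / 2 := by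
        gcongr
        exact one_sub_algSigmoid_le hm hM1
    _ = 1 / (4 * m * (M - 1) ^ (2 * m)) := by
        rw [div_div]
        ring_nf

lemma sum_algDensity_le_of_le_sub' {m : ℕ} (hm : m ≠ 0) {t M : ℝ} (hM : 1 < M) (s : Finset ℤ)
    (hs : ∀ k ∈ s, M ≤ k - t) :
    ∑ k ∈ s, algDensity m (t - k) ≤ 1 / (4 * m * (M - 1) ^ (2 * m)) := by
  have hreflect := sum_algDensity_le_of_le_sub hm (t := -t) hM (s.image Neg.neg) fun k hk => by
    obtain ⟨l, hl, rfl⟩ := Finset.mem_image.1 hk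
    push_cast
    linarith [hs l hl]
  rw [Finset.sum_image fun _ _ _ _ => neg_inj.1] at hreflect
  refine (Finset.sum_congr rfl fun k _ => ?_).trans_le hreflect
  rw [← algDensity_neg, Int.cast_neg, neg_sub, sub_neg_eq_add, neg_add_eq_sub]

lemma algDensity_one_le_sum {m : ℕ} (hm : m ≠ 0) {t : ℝ} {s : Finset ℤ} {k : ℤ} (hk : k ∈ s)
    (htk : |t - k| ≤ 1) : algDensity m 1 ≤ ∑ k ∈ s, algDensity m (t - k) :=
  (algDensity_one_le htk).trans <|
    Finset.single_le_sum (f := fun k : ℤ => algDensity m (t - k))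
      (fun _ _ => algDensity_nonneg hm _) hk

lemma two_mul_algDensity_one_le_sum_Icc {m : ℕ} (hm : m ≠ 0) {t : ℝ} {p q : ℤ} (hp : p ≤ t)
    (hq : t < q) : 2 * algDensity m 1 ≤ ∑ k ∈ Finset.Icc p q, algDensity m (t - k) := by
  have hfloor := Int.floor_le t
  have hfloor' := Int.lt_floor_add_one t
  have hpf : p ≤ ⌊t⌋ := Int.le_floor.2 hp
  have hfq : ⌊t⌋ < q := Int.floor_lt.2 hq
  calc 2 * algDensity m 1 ≤ algDensity m (t - ⌊t⌋) + algDensity m (t - (⌊t⌋ + 1 : ℤ)) := by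
        rw [two_mul]
        push_cast
        exact add_le_add (algDensity_one_le (abs_le.2 ⟨by linarith, by linarith⟩))
          (algDensity_one_le (abs_le.2 ⟨by linarith, by linarith⟩))
    _ = ∑ k ∈ ({⌊t⌋, ⌊t⌋ + 1} : Finset ℤ), algDensity m (t - k) :=
        by rw [Finset.sum_pair (by omega)]
    _ ≤ ∑ k ∈ Finset.Icc p q, algDensity m (t - k) := by
        refine Finset.sum_le_sum_of_subset_of_nonneg ?_ fun k _ _ => algDensity_nonneg hm _
        simp only [Finset.insert_subset_iff, Finset.singleton_subset_iff, Finset.mem_Icc]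
        omega

lemma algDensity_one_le_sum_Icc {m : ℕ} (hm : m ≠ 0) {t : ℝ} {p q : ℤ} (hpq : p ≤ q)
    (hp : p ≤ t + 1) (hq : t - 1 ≤ q) :
    algDensity m 1 ≤ ∑ k ∈ Finset.Icc p q, algDensity m (t - k) := by
  rcases lt_or_ge t p with htp | hpt
  · exact algDensity_one_le_sum hm (Finset.left_mem_Icc.2 hpq)
      (abs_le.2 ⟨by linarith, by linarith⟩)
  rcases lt_or_ge t q with htq | hqt
  · linarith [two_mul_algDensity_one_le_sum_Icc hm hpt htq, algDensity_one_pos m]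
  · exact algDensity_one_le_sum hm (Finset.right_mem_Icc.2 hpq)
      (abs_le.2 ⟨by linarith, by linarith⟩)

lemma sum_filter_algDensity_le {m : ℕ} (hm : m ≠ 0) {t M : ℝ} (hM : 1 < M) (s : Finset ℤ) :
    ∑ k ∈ s with M ≤ |t - (k : ℤ)|, algDensity m (t - k) ≤
      2 * (1 / (4 * m * (M - 1) ^ (2 * m))) := by
  have hdisj : Disjoint {k ∈ s | M ≤ t - (k : ℤ)} {k ∈ s | M ≤ (k : ℤ) - t} :=
    Finset.disjoint_filter.2 fun k _ hright hleft => by linarith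
  have hsplit : {k ∈ s | M ≤ |t - (k : ℤ)|} =
      {k ∈ s | M ≤ t - (k : ℤ)} ∪ {k ∈ s | M ≤ (k : ℤ) - t} := by
    simp only [le_abs, neg_sub, Finset.filter_or]
  rw [hsplit, Finset.sum_union hdisj, two_mul]
  exact add_le_add
    (sum_algDensity_le_of_le_sub hm hM _ fun k hk => (Finset.mem_filter.1 hk).2)
    (sum_algDensity_le_of_le_sub' hm hM _ fun k hk => (Finset.mem_filter.1 hk).2)

-- If both tails are present, then both integer neighbours of `t` are indices, so the full sum is
-- at least `2Φ(1)`; this avoids losing a factor `2`.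
lemma algDensity_one_mul_sum_filter_le {m : ℕ} (hm : m ≠ 0) {t M : ℝ} (hM : 1 < M) {p q : ℤ}
    (hpq : p ≤ q) (hp : p ≤ t + 1) (hq : t - 1 ≤ q) :
    algDensity m 1 * ∑ k ∈ Finset.Icc p q with M ≤ |t - (k : ℤ)|, algDensity m (t - k) ≤
      1 / (4 * m * (M - 1) ^ (2 * m)) * ∑ k ∈ Finset.Icc p q, algDensity m (t - k) := by
  have hΦ := algDensity_one_pos m
  have hone := algDensity_one_le_sum_Icc hm hpq hp hq
  have hT : 0 ≤ 1 / (4 * m * (M - 1) ^ (2 * m)) := by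
    have := sub_pos.2 hM
    positivity
  have hone_sided {R : ℝ} (hR : R ≤ 1 / (4 * m * (M - 1) ^ (2 * m))) :
      algDensity m 1 * R ≤
        1 / (4 * m * (M - 1) ^ (2 * m)) * ∑ k ∈ Finset.Icc p q, algDensity m (t - k) := by
    rw [mul_comm]
    exact mul_le_mul hR hone hΦ.le hT
  rcases lt_or_ge t p with htp | hpt
  · refine hone_sided (sum_algDensity_le_of_le_sub' hm hM _ fun k hk => ?_)
    obtain ⟨hk, hMk⟩ := Finset.mem_filter.1 hk
    have : (p : ℝ) ≤ k := Int.cast_le.2 (Finset.mem_Icc.1 hk).1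
    rwa [abs_of_neg (by linarith), neg_sub] at hMk
  rcases lt_or_ge t q with htq | hqt
  · have htwo := two_mul_algDensity_one_le_sum_Icc hm hpt htq
    linarith [mul_le_mul_of_nonneg_left (sum_filter_algDensity_le hm hM (t := t) (Finset.Icc p q))
      hΦ.le, mul_le_mul_of_nonneg_left htwo hT]
  · refine hone_sided (sum_algDensity_le_of_le_sub hm hM _ fun k hk => ?_)
    obtain ⟨hk, hMk⟩ := Finset.mem_filter.1 hk
    have : (k : ℝ) ≤ q := Int.cast_le.2 (Finset.mem_Icc.1 hk).2
    rwa [abs_of_nonneg (by linarith)] at hMk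

end AlgDensitySums

section Operator

lemma abs_sum_mul_div_sum_sub_le {ι K : Type*} [Field K] [LinearOrder K] [IsStrictOrderedRing K]
    {s : Finset ι} {w g : ι → K} {c P Q : K} (far : ι → Prop) [DecidablePred far]
    (hw : ∀ i ∈ s, 0 ≤ w i) (hs : 0 < ∑ i ∈ s, w i) (hP : 0 ≤ P)
    (hnear : ∀ i ∈ s, ¬far i → |g i - c| ≤ P) (hfar : ∀ i ∈ s, far i → |g i - c| ≤ Q) :
    |(∑ i ∈ s, g i * w i) / (∑ i ∈ s, w i) - c| ≤
      P + Q * ((∑ i ∈ s with far i, w i) / ∑ i ∈ s, w i) := by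
  have hterm (i) (hi : i ∈ s) : |(g i - c) * w i| ≤ P * w i + if far i then Q * w i else 0 := by
    have hwi := hw i hi
    rw [abs_mul, abs_of_nonneg hwi]
    split_ifs with h
    · exact (mul_le_mul_of_nonneg_right (hfar i hi h) hwi).trans
        (le_add_of_nonneg_left (mul_nonneg hP hwi))
    · rw [add_zero]
      exact mul_le_mul_of_nonneg_right (hnear i hi h) hwi
  have hsub : (∑ i ∈ s, g i * w i) / (∑ i ∈ s, w i) - c =
      (∑ i ∈ s, (g i - c) * w i) / ∑ i ∈ s, w i := by
    simp only [sub_mul, Finset.sum_sub_distrib, ← Finset.mul_sum]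
    rw [sub_div, mul_div_cancel_right₀ _ hs.ne']
  rw [hsub, abs_div, abs_of_pos hs, div_le_iff₀ hs]
  calc |∑ i ∈ s, (g i - c) * w i|
      ≤ ∑ i ∈ s, (P * w i + if far i then Q * w i else 0) :=
        (Finset.abs_sum_le_sum_abs _ _).trans (Finset.sum_le_sum hterm)
    _ = P * ∑ i ∈ s, w i + Q * ∑ i ∈ s with far i, w i := by
        rw [Finset.sum_add_distrib, ← Finset.mul_sum, ← Finset.sum_filter, ← Finset.mul_sum]
    _ = (P + Q * ((∑ i ∈ s with far i, w i) / ∑ i ∈ s, w i)) * ∑ i ∈ s, w i := by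
        rw [add_mul, mul_assoc, div_mul_cancel₀ _ hs.ne']

variable {m n : ℕ} {a b x M : ℝ} {f : ℝ → ℝ}

lemma intCast_div_natCast_mem_Icc {k : ℤ} (hn : 0 < n)
    (hk : k ∈ Finset.Icc ⌈(n : ℝ) * a⌉ ⌊(n : ℝ) * b⌋) : (k : ℝ) / n ∈ Set.Icc a b := by
  have hn' : (0 : ℝ) < n := Nat.cast_pos.2 hn
  obtain ⟨hak, hkb⟩ := Finset.mem_Icc.1 hk
  exact ⟨(le_div_iff₀' hn').2 (Int.ceil_le.1 hak), (div_le_iff₀' hn').2 (Int.le_floor.1 hkb)⟩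

lemma abs_intCast_div_natCast_sub (hn : 0 < n) (k : ℤ) (x : ℝ) :
    |(k : ℝ) / n - x| = |n * x - k| / n := by
  have hn' : (0 : ℝ) < n := Nat.cast_pos.2 hn
  rw [div_sub' hn'.ne', abs_div, abs_of_pos hn', abs_sub_comm]

lemma abs_nnOperator_sub_le_of_monotoneOn {ω : ℝ → ℝ} (hm : m ≠ 0) (hn : 0 < n)
    (hx : x ∈ Set.Icc a b) (hgrid : ⌈(n : ℝ) * a⌉ ≤ ⌊(n : ℝ) * b⌋) (hM : 1 < M)
    (hω : MonotoneOn ω (Set.Ici 0)) (hf : ∀ y ∈ Set.Icc a b, |f y - f x| ≤ ω |y - x|) :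
    |nnOperator m a b n f x - f x| ≤
      ω (M / n) + (algDensity m 1)⁻¹ * (ω (b - a) * (1 / (4 * m * (M - 1) ^ (2 * m)))) := by
  have hn' : (0 : ℝ) < n := Nat.cast_pos.2 hn
  have hω0 : 0 ≤ ω 0 := by simpa using hf x hx
  have hω_nonneg {h : ℝ} (hh : 0 ≤ h) : 0 ≤ ω h := hω0.trans (hω Set.self_mem_Ici hh hh)
  have hba : 0 ≤ b - a := sub_nonneg.2 (hx.1.trans hx.2)
  have hMn : 0 ≤ M / n := by positivity
  have hp : (⌈(n : ℝ) * a⌉ : ℝ) ≤ n * x + 1 := by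
    linarith [Int.ceil_lt_add_one ((n : ℝ) * a), mul_le_mul_of_nonneg_left hx.1 hn'.le]
  have hq : n * x - 1 ≤ (⌊(n : ℝ) * b⌋ : ℝ) := by
    linarith [Int.sub_one_lt_floor ((n : ℝ) * b), mul_le_mul_of_nonneg_left hx.2 hn'.le]
  have hΦ := algDensity_one_pos m
  have hS := hΦ.trans_le (algDensity_one_le_sum_Icc hm hgrid hp hq)
  have htail := algDensity_one_mul_sum_filter_le hm hM hgrid hp hq
  rw [← le_div_iff₀' hΦ, mul_div_right_comm, ← div_le_iff₀ hS, div_eq_inv_mul _ (algDensity m 1)]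
    at htail
  refine (abs_sum_mul_div_sum_sub_le (fun k : ℤ => M ≤ |n * x - k|)
    (fun k _ => algDensity_nonneg hm _) hS (hω_nonneg hMn)
    (fun k hk hkM => ?_) fun k hk _ => ?_).trans
      (add_le_add_right (mul_le_mul_of_nonneg_left htail (hω_nonneg hba)) _ |>.trans_eq (by ring))
  · refine (hf _ (intCast_div_natCast_mem_Icc hn hk)).trans
      (hω (Set.mem_Ici.2 (abs_nonneg _)) hMn ?_)
    rw [abs_intCast_div_natCast_sub hn]
    exact div_le_div_of_nonneg_right (not_le.1 hkM).le hn'.le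
  · have hy := intCast_div_natCast_mem_Icc hn hk
    exact (hf _ hy).trans (hω (Set.mem_Ici.2 (abs_nonneg _)) hba (Real.dist_le_of_mem_Icc hy hx))

end Operator

section Rate

/-- The contribution of a term `|y - x| ^ γ` in a bound for `|f y - f x|` to the error of `A_n f`
at `x`, on an interval of length `L`: nodes within `n ^ (-α)` of `x` give the first summand, all
other nodes the second. -/
def nnRate (m : ℕ) (α L γ : ℝ) (n : ℕ) : ℝ :=
  1 / (n : ℝ) ^ (α * γ) + L ^ γ / (4 * m * ((n : ℝ) ^ (1 - α) - 2) ^ (2 * m))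

lemma tendsto_natCast_rpow_atTop {γ : ℝ} (hγ : 0 < γ) :
    Tendsto (fun n : ℕ => (n : ℝ) ^ γ) atTop atTop :=
  (tendsto_rpow_atTop hγ).comp tendsto_natCast_atTop_atTop

variable {m : ℕ} {α : ℝ}

lemma tendsto_nnRate {γ : ℝ} (hm : m ≠ 0) (hα0 : 0 < α) (hα1 : α < 1) (L : ℝ) (hγ : 0 < γ) :
    Tendsto (nnRate m α L γ) atTop (𝓝 0) := by
  have hm' : (0 : ℝ) < 4 * m := by positivity
  have hfar : Tendsto (fun n : ℕ => 4 * m * ((n : ℝ) ^ (1 - α) - 2) ^ (2 * m)) atTop atTop :=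
    ((tendsto_pow_atTop (mul_ne_zero two_ne_zero hm)).comp (tendsto_atTop_add_const_right _ (-2)
      (tendsto_natCast_rpow_atTop (sub_pos.2 hα1)))).const_mul_atTop hm'
  rw [← add_zero (0 : ℝ)]
  exact ((tendsto_natCast_rpow_atTop (mul_pos hα0 hγ)).const_div_atTop 1).add
    (hfar.const_div_atTop (L ^ γ))

lemma abs_nnOperator_sub_le_nnRate {a b x C β γ : ℝ} {n : ℕ} {f : ℝ → ℝ} (hm : m ≠ 0)
    (hα1 : α < 1) (hC : 0 ≤ C) (hβ : 0 ≤ β) (hγ : 0 ≤ γ) (hx : x ∈ Set.Icc a b)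
    (hf : ∀ y ∈ Set.Icc a b, |f y - f x| ≤ C * (|y - x| ^ β + |y - x| ^ γ))
    (hn : 2 < (n : ℝ) ^ (1 - α)) (hgrid : ⌈(n : ℝ) * a⌉ ≤ ⌊(n : ℝ) * b⌋) :
    |nnOperator m a b n f x - f x| ≤ 2 * (1 + (4 : ℝ) ^ m) ^ (1 / (2 * (m : ℝ))) * C *
      (nnRate m α (b - a) β n + nnRate m α (b - a) γ n) := by
  have hn0 : 0 < n := Nat.pos_of_ne_zero fun h => by
    rw [h, Nat.cast_zero, Real.zero_rpow (sub_pos.2 hα1).ne'] at hn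
    linarith
  have hn' : (0 : ℝ) < n := Nat.cast_pos.2 hn0
  have hba : 0 ≤ b - a := sub_nonneg.2 (hx.1.trans hx.2)
  have hω : MonotoneOn (fun h : ℝ => C * (h ^ β + h ^ γ)) (Set.Ici 0) := fun u hu v _ huv => by
    have hu : 0 ≤ u := hu
    dsimp only
    gcongr
  have hnear (c : ℝ) : ((n : ℝ) ^ (1 - α) / n) ^ c = 1 / (n : ℝ) ^ (α * c) := by
    rw [Real.rpow_sub hn', Real.rpow_one, div_right_comm, div_self hn'.ne',
      Real.div_rpow zero_le_one (by positivity), Real.one_rpow, Real.rpow_mul hn'.le]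
  have herr := abs_nnOperator_sub_le_of_monotoneOn hm hn0 hx hgrid (one_lt_two.trans hn) hω hf
  rw [inv_algDensity_one, hnear, hnear] at herr
  set K := (1 + (4 : ℝ) ^ m) ^ (1 / (2 * (m : ℝ)))
  have hK : 1 ≤ K := Real.one_le_rpow (le_add_of_nonneg_right (by positivity)) (by positivity)
  have : 0 < (n : ℝ) ^ (1 - α) - 2 := sub_pos.2 hn
  calc |nnOperator m a b n f x - f x|
      ≤ 2 * K * (C * (1 / (n : ℝ) ^ (α * β) + 1 / (n : ℝ) ^ (α * γ))) +
          2 * K * (C * ((b - a) ^ β + (b - a) ^ γ) *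
            (1 / (4 * m * ((n : ℝ) ^ (1 - α) - 2) ^ (2 * m)))) := by
        refine herr.trans (add_le_add (le_mul_of_one_le_left (by positivity) (by linarith)) ?_)
        gcongr
        norm_num
    _ = 2 * K * C * (nnRate m α (b - a) β n + nnRate m α (b - a) γ n) := by
        rw [nnRate, nnRate]
        ring

lemma eventually_ceil_le_floor {a b : ℝ} (hab : a < b) :
    ∀ᶠ n : ℕ in atTop, ⌈(n : ℝ) * a⌉ ≤ ⌊(n : ℝ) * b⌋ := by
  have hlength := (tendsto_natCast_atTop_atTop (R := ℝ)).atTop_mul_const (sub_pos.2 hab)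
  filter_upwards [hlength.eventually_ge_atTop 1] with n hn
  exact Int.le_floor.2 (by linarith [Int.ceil_lt_add_one ((n : ℝ) * a)])

end Rate

end

theorem corollary38_general {a b : ℝ} (hab : a < b) {α : ℝ} (hα0 : 0 < α) (hα1 : α < 1)
    {m : ℕ} (hm : m ≠ 0) {N : ℕ} {f : ℝ → ℝ} {x : ℝ} (hx : x ∈ Set.Icc a b)
    (hLac : ∀ k ≤ N, AbsolutelyContinuousOnInterval (iterLeftCaputo α x k f) x b)
    (hRac : ∀ k ≤ N, AbsolutelyContinuousOnInterval (iterRightCaputo α x k f) a x)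
    (hLc : ContinuousOn (iterLeftCaputo α x (N + 1) f) (Set.Icc x b))
    (hRc : ContinuousOn (iterRightCaputo α x (N + 1) f) (Set.Icc a x)) :
    (∀ n : ℕ, 2 < (n : ℝ) ^ (1 - α) → ⌈(n : ℝ) * a⌉ ≤ ⌊(n : ℝ) * b⌋ →
      |nnOperator m a b n f x - f x| ≤
        2 * (1 + (4 : ℝ) ^ m) ^ (1 / (2 * (m : ℝ))) *
            iterModulus α a b x (N + 1) f (1 / (((N : ℝ) + 1) * α + 1)) /
          Real.Gamma (((N : ℝ) + 1) * α + 1) *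
        ((1 / (n : ℝ) ^ (((N : ℝ) + 1) * α ^ 2) +
            (b - a) ^ (((N : ℝ) + 1) * α) /
              (4 * (m : ℝ) * ((n : ℝ) ^ (1 - α) - 2) ^ (2 * m))) +
          (1 / (n : ℝ) ^ (α * (((N : ℝ) + 1) * α + 1)) +
            (b - a) ^ (((N : ℝ) + 1) * α + 1) /
              (4 * (m : ℝ) * ((n : ℝ) ^ (1 - α) - 2) ^ (2 * m))))) ∧
    Tendsto (fun n : ℕ => nnOperator m a b n f x) atTop (𝓝 (f x)) := by
  have hβ : 0 < ((N : ℝ) + 1) * α := by positivity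
  have hγ : 0 < ((N : ℝ) + 1) * α + 1 := by positivity
  have hΓ := Real.Gamma_pos_of_pos hγ
  have herr {n : ℕ} := abs_nnOperator_sub_le_nnRate (n := n) hm hα1
    (div_nonneg (iterModulus_nonneg ..) hΓ.le) hβ.le hγ.le hx
    fun y hy => abs_sub_le_iterModulus hα0 hα1 hLac hRac hLc hRc hy
  have hrate := ((tendsto_nnRate hm hα0 hα1 (b - a) hβ).add
    (tendsto_nnRate hm hα0 hα1 (b - a) hγ)).const_mul
      (2 * (1 + (4 : ℝ) ^ m) ^ (1 / (2 * (m : ℝ))) *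
        (iterModulus α a b x (N + 1) f (1 / (((N : ℝ) + 1) * α + 1)) /
          Real.Gamma (((N : ℝ) + 1) * α + 1)))
  rw [add_zero, mul_zero] at hrate
  refine ⟨fun n hn hgrid => ?_, ?_⟩
  · rw [show ((N : ℝ) + 1) * α ^ 2 = α * (((N : ℝ) + 1) * α) by ring, mul_div_assoc]
    exact herr hn hgrid
  · refine tendsto_iff_norm_sub_tendsto_zero.2
      (squeeze_zero' (.of_forall fun _ => norm_nonneg _) ?_ hrate)
    filter_upwards [(tendsto_natCast_rpow_atTop (sub_pos.2 hα1)).eventually_gt_atTop 2,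
      eventually_ceil_le_floor hab] with n hn hgrid using herr hn hgrid

theorem corollary38
    (a b : ℝ) (hab : a < b)
    (α : ℝ) (hα0 : 0 < α) (hα1 : α < 1)
    (m : ℕ) (hm : 1 ≤ m)
    (N : ℕ) (hN : 1 ≤ N)
    (f : ℝ → ℝ)
    (hfc : ContinuousOn f (Set.Icc a b))
    -- `f' ∈ L_∞([a, b])`
    (hfac : AbsolutelyContinuousOnInterval f a b)
    (hf' : MemLp (deriv f) ⊤ (volume.restrict (Set.Icc a b)))
    (x : ℝ) (hx : x ∈ Set.Icc a b)
    -- the iterated derivatives up to order `N + 1` are defined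
    (hLac : ∀ k ≤ N, AbsolutelyContinuousOnInterval (iterLeftCaputo α x k f) x b)
    (hRac : ∀ k ≤ N, AbsolutelyContinuousOnInterval (iterRightCaputo α x k f) a x)
    (hLc : ∀ k ≤ N + 1, ContinuousOn (iterLeftCaputo α x k f) (Set.Icc x b))
    (hL0 : ∀ i, 2 ≤ i → i ≤ N + 1 → iterLeftCaputo α x i f x = 0)
    (hRc : ∀ k ≤ N + 1, ContinuousOn (iterRightCaputo α x k f) (Set.Icc a x))
    (hR0 : ∀ i, 2 ≤ i → i ≤ N + 1 → iterRightCaputo α x i f x = 0) :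
    (∀ n : ℕ, 2 < (n : ℝ) ^ (1 - α) → ⌈(n : ℝ) * a⌉ ≤ ⌊(n : ℝ) * b⌋ →
      |nnOperator m a b n f x - f x| ≤
        2 * (1 + (4 : ℝ) ^ m) ^ (1 / (2 * (m : ℝ))) *
            iterModulus α a b x (N + 1) f (1 / (((N : ℝ) + 1) * α + 1)) /
          Real.Gamma (((N : ℝ) + 1) * α + 1) *
        ((1 / (n : ℝ) ^ (((N : ℝ) + 1) * α ^ 2) +
            (b - a) ^ (((N : ℝ) + 1) * α) /
              (4 * (m : ℝ) * ((n : ℝ) ^ (1 - α) - 2) ^ (2 * m))) +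
          (1 / (n : ℝ) ^ (α * (((N : ℝ) + 1) * α + 1)) +
            (b - a) ^ (((N : ℝ) + 1) * α + 1) /
              (4 * (m : ℝ) * ((n : ℝ) ^ (1 - α) - 2) ^ (2 * m))))) ∧
    Tendsto (fun n : ℕ => nnOperator m a b n f x) atTop (𝓝 (f x)) := by
  exact corollary38_general hab hα0 hα1 (Nat.one_le_iff_ne_zero.1 hm) hx hLac hRac
    (hLc _ le_rfl) (hRc _ le_rfl)
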